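/- Let $d\in\{2,3\}$ and let $\Omega\subset\mathbb R^d$ be a bounded domain with $C^1$ boundary and surface measure $ds$. Let $\mathcal N_1(x,y)$ be the Neumann function of $\Omega$ with unit coefficient: for every $x\in\Omega$, $$-\Delta_y\mathcal N_1(x,y)=\delta(x-y)\ \text{ for } y\in\Omega,\qquad -\frac{\partial}{\partial n_y}\mathcal N_1(x,y)=\frac1{|\partial\Omega|}\ \text{ for } y\in\partial\Omega,\qquad \int_{\partial\Omega}\mathcal N_1(x,y)\,ds_y=0,$$ where $\mathcal N_1(x,\cdot)\in W^{1,1}(\Omega)$ is of class $C^1$ on $\overline\Omega\setminus\{x\}$ (up to the boundary), and where $\mathcal N_1$ is extended to $x\in\partial\Omega$ so as to be continuous on $\{(x,y)\in\overline\Omega\times\overline\Omega: x\ne y\}$. Let $p_{k^+},p_{k^-},p_{l^+},p_{l^-}\in\partial\Omega$ with $p_{l^\pm}\notin\{p_{k^+},p_{k^-}\}$, let $I\in\mathbb R$, and let $\gamma$ be a complex admittivity. Let $u_k\in W^{1,1}(\Omega)$ be complex valued, continuous on $\overline\Omega\setminus\{p_{k^+},p_{k^-}\}$, and a solution of the point electrode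 model $$\nabla\cdot(\gamma\nabla u_k)=0\ \text{ in }\Omega,\qquad \gamma\frac{\partial u_k}{\partial n}=I\,(\delta_{p_{k^+}}-\delta_{p_{k^-}})\ \text{ on }\partial\Omega,\qquad \int_{\partial\Omega}u_k\,ds=0,$$ and put $U_{k,l}:=u_k(p_{l^+})-u_k(p_{l^-})$. The equations with their boundary conditions, for $\mathcal N_1$ and for $u_k$, are understood in the weak sense: $$\int_\Omega\nabla_y\mathcal N_1(x,y)\cdot\nabla\varphi(y)\,dy=\varphi(x)-\frac1{|\partial\Omega|}\int_{\partial\Omega}\varphi\,ds,\qquad \int_\Omega\gamma\nabla u_k\cdot\nabla\varphi\,dy=I\,(\varphi(p_{k^+})-\varphi(p_{k^-}))$$ for all real $\varphi\in C^1(\overline\Omega)$, and the boundary values of $\mathcal N_1(x,\cdot)$ and of $u_k$ are their traces. If $\gamma$ is constant in $\Omega$ and $U_{k,l}\neq0$, then $$\gamma=\frac{I}{U_{k,l}}\Bigl(\mathcal N_1(p_{k^+},p_{l^+})-\mathcal N_1(p_{k^+},p_{l^-})-\mathcal N_1(p_{k^-},p_{l^+})+\mathcal N_1(p_{k^-},p_{l^-})\Bigr).$$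 -/

import Mathlib

open MeasureTheory Filter Topology Set

noncomputable section

namespace EIT

/-- Euclidean space of dimension `d`. -/
abbrev E (d : ℕ) : Type := EuclideanSpace ℝ (Fin d)

/-- A bounded domain (nonempty, open, connected) with `C¹` boundary: near each boundary point the
set is the strict sublevel set of a `C¹` function with nonvanishing derivative at that point. -/
structure IsC1Domain {d : ℕ} (Ω : Set (E d)) : Prop where
  isOpen : IsOpen Ω
  isConnected : IsConnected Ω
  isBounded : Bornology.IsBounded Ω
  exists_defining : ∀ p ∈ frontier Ω, ∃ V ∈ 𝓝 p, ∃ ρ : E d → ℝ,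
    ContDiff ℝ 1 ρ ∧ fderiv ℝ ρ p ≠ 0 ∧ ∀ x ∈ V, (x ∈ Ω ↔ ρ x < 0)

/-- The surface measure `ds` on `∂Ω`: the `(d - 1)`-dimensional Hausdorff measure, in the Euclidean
normalization, restricted to the boundary. -/
def surfaceMeasure {d : ℕ} (Ω : Set (E d)) : Measure (E d) :=
  (Measure.euclideanHausdorffMeasure (d - 1)).restrict (frontier Ω)

/-- `∇f · ∇φ`, in terms of the derivatives `A` of `f` and `B` of the real function `φ`. -/
def gradDot {d : ℕ} {F : Type*} [NormedAddCommGroup F] [NormedSpace ℝ F]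
    (A : E d →L[ℝ] F) (B : E d →L[ℝ] ℝ) : F :=
  ∑ i : Fin d, B (EuclideanSpace.single i 1) • A (EuclideanSpace.single i 1)

/-- `f` belongs to `C¹(closure Ω \ P)`: it is continuous there, differentiable in `Ω \ P`, and its
derivative extends continuously to `closure Ω \ P`. -/
def IsC1UpToBoundary {d : ℕ} {F : Type*} [NormedAddCommGroup F] [NormedSpace ℝ F]
    (Ω P : Set (E d)) (f : E d → F) : Prop :=
  ContinuousOn f (closure Ω \ P) ∧
    ∃ D : E d → E d →L[ℝ] F, ContinuousOn D (closure Ω \ P) ∧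
      ∀ y ∈ Ω \ P, HasFDerivAt f (D y) y

/-- `u` belongs to the Sobolev space `W^{1,1}(Ω)` with gradient `G`, and the restriction of `u` to
`∂Ω` is its trace in `L¹(∂Ω)`. The space is the completion of `C¹(closure Ω)`, and the trace
operator is the continuous extension of the restriction to the boundary. -/
structure HasW11Grad {d : ℕ} {F : Type*} [NormedAddCommGroup F] [NormedSpace ℝ F]
    (Ω : Set (E d)) (u : E d → F) (G : E d → E d →L[ℝ] F) : Prop where
  integrable : IntegrableOn u Ω
  integrable_grad : IntegrableOn G Ω
  integrable_trace : Integrable u (surfaceMeasure Ω)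
  exists_approx : ∃ φ : ℕ → E d → F, (∀ n, IsC1UpToBoundary Ω ∅ (φ n)) ∧
    Tendsto (fun n => eLpNorm (fun y => φ n y - u y) 1 (volume.restrict Ω)) atTop (𝓝 0) ∧
    Tendsto (fun n => eLpNorm (fun y => fderiv ℝ (φ n) y - G y) 1 (volume.restrict Ω))
      atTop (𝓝 0) ∧
    Tendsto (fun n => eLpNorm (fun y => φ n y - u y) 1 (surfaceMeasure Ω)) atTop (𝓝 0)

/-- `u` solves the point electrode model with admittivity `γ`, injected current `I` and injection
electrodes at `pp` (source) and `pm` (sink):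
`∇ · (γ ∇u) = 0` in `Ω`, `γ ∂u/∂n = I (δ_pp - δ_pm)` on `∂Ω`, `∫_{∂Ω} u ds = 0`.
The first two equations are in weak form, with test functions in `C¹(closure Ω)`. Off the injection
points `u` is continuous up to the boundary, so that it has point values there. -/
structure IsPointElectrodeSolution {d : ℕ} (Ω : Set (E d)) (γ : E d → ℂ) (I : ℝ) (pp pm : E d)
    (u : E d → ℂ) : Prop where
  continuousOn : ContinuousOn u (closure Ω \ {pp, pm})
  weak_form : ∃ G : E d → E d →L[ℝ] ℂ, HasW11Grad Ω u G ∧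
    IntegrableOn (fun y => γ y • G y) Ω ∧
    ∀ φ : E d → ℝ, IsC1UpToBoundary Ω ∅ φ →
      ∫ y in Ω, γ y * gradDot (G y) (fderiv ℝ φ y) = (I : ℂ) * ((φ pp : ℂ) - (φ pm : ℂ))
  integral_boundary : ∫ y, u y ∂(surfaceMeasure Ω) = 0

/-- The voltage difference between the points `qp` and `qm`. -/
def voltage {d : ℕ} (u : E d → ℂ) (qp qm : E d) : ℂ := u qp - u qm

/-- `N` is the Neumann function of `Ω` with unit coefficient: for each `x ∈ Ω`,
`-Δ_y N(x, ·) = δ_x` in `Ω`, `-∂N(x, ·)/∂n_y = 1 / |∂Ω|` on `∂Ω`, `∫_{∂Ω} N(x, y) ds_y = 0`.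
The first two equations are in weak form, `N(x, ·)` being integrable with integrable gradient and
of class `C¹` up to the boundary off the pole `x`.
The values for `x ∈ ∂Ω` are those of the continuous extension off the diagonal. -/
structure IsNeumannFunction {d : ℕ} (Ω : Set (E d)) (N : E d → E d → ℝ) : Prop where
  continuousOn : ContinuousOn (fun q : E d × E d => N q.1 q.2)
    {q | q.1 ∈ closure Ω ∧ q.2 ∈ closure Ω ∧ q.1 ≠ q.2}
  isC1 : ∀ x ∈ Ω, IsC1UpToBoundary Ω {x} (N x)
  hasW11Grad : ∀ x ∈ Ω, HasW11Grad Ω (N x) (fderiv ℝ (N x))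
  weak_form : ∀ x ∈ Ω, ∀ φ : E d → ℝ, IsC1UpToBoundary Ω ∅ φ →
    ∫ y in Ω, gradDot (fderiv ℝ (N x) y) (fderiv ℝ φ y) =
      φ x - 1 / (surfaceMeasure Ω).real univ * ∫ y, φ y ∂(surfaceMeasure Ω)
  integral_boundary : ∀ x ∈ Ω, ∫ y, N x y ∂(surfaceMeasure Ω) = 0

end EIT

end

open scoped ContDiff Convolution

namespace EIT

/-! ### Passage to the limit under `L¹` convergence. -/

section Convergence

variable {α X : Type*} [MeasurableSpace α] {μ : Measure α} [NormedAddCommGroup X]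

/-! For a nonzero constant admittivity, `u x = I / γ₀ * (N x pp - N x pm)` at interior points.
Continuity and the symmetry of `N` carry this to the boundary, and the difference of its values at
the two measuring points is then solved for `γ₀`.

Formally the interior formula comes from testing the equation of `u` with `N x`. But `N x` is
singular at `x` and `u` is only in `W^{1,1}`, so neither may test the equation of the other. With a
cutoff `χ` equal to `1` near `x`, the function `(1 - χ) * N x` is admissible, and its boundary
values are those of `N x`. What remains is that its weak pairing with the gradient of `u` is `u x`
(`HasW11Grad.eq_integral_gradDot`). Away from `x` the gradient of `N x` is bounded, so the equation
of `N x` extends by density to `(1 - χ) * u` (`HasW11Grad.integral_cutoff`). The terms where the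
cutoff varies collect into the continuous kernel `reprKernel`, formally `Δ(χ f) + δ_x` with `f = N
x`. It reproduces smooth harmonic functions by Green's formula, and continuous weakly harmonic ones
by mollification (`eq_integral_mul_of_weakly_harmonic`).

The same test function, paired with `N z` in place of `u`, gives the symmetry of `N`. The factor `1
/ |∂Ω|` only ever multiplies boundary integrals that vanish. -/

theorem eventually_integrable_of_tendsto_eLpNorm {f : ℕ → α → X} {g : α → X} (hg : Integrable g μ)
    (hf : ∀ n, AEStronglyMeasurable (f n) μ)
    (h : Tendsto (fun n => eLpNorm (fun y => f n y - g y) 1 μ) atTop (𝓝 0)) :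
    ∀ᶠ n in atTop, Integrable (f n) μ := by
  filter_upwards [h.eventually (gt_mem_nhds ENNReal.zero_lt_top)] with n hn
  have h1 : Integrable (fun y => f n y - g y) μ :=
    memLp_one_iff_integrable.1 ⟨(hf n).sub hg.1, hn⟩
  exact (h1.add hg).congr (Eventually.of_forall fun y => by simp)

variable [NormedSpace ℝ X]

theorem integrable_clm_apply {A : α → X →L[ℝ] ℝ} {f : α → X} {C : ℝ}
    (hA : AEStronglyMeasurable A μ) (hC : ∀ᵐ y ∂μ, ‖A y‖ ≤ C) (hf : Integrable f μ) :
    Integrable (fun y => A y (f y)) μ := by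
  refine (hf.norm.const_mul C).mono' 
    (isBoundedBilinearMap_apply.continuous.comp_aestronglyMeasurable (hA.prodMk hf.1)) ?_
  filter_upwards [hC] with y hy
  exact (A y).le_of_opNorm_le hy _

/-- Integration against a bounded family of functionals is continuous along `L¹` convergence. -/
theorem tendsto_integral_clm_apply {A : α → X →L[ℝ] ℝ} {f : ℕ → α → X} {g : α → X} {C : ℝ}
    (hA : AEStronglyMeasurable A μ) (hC : ∀ᵐ y ∂μ, ‖A y‖ ≤ C) (hg : Integrable g μ)
    (hf : ∀ n, AEStronglyMeasurable (f n) μ)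
    (h : Tendsto (fun n => eLpNorm (fun y => f n y - g y) 1 μ) atTop (𝓝 0)) :
    Tendsto (fun n => ∫ y, A y (f n y) ∂μ) atTop (𝓝 (∫ y, A y (g y) ∂μ)) := by
  have hfin := eventually_integrable_of_tendsto_eLpNorm hg hf h
  refine tendsto_integral_of_L1' _ (integrable_clm_apply hA hC hg).1 ?_ ?_
  · filter_upwards [hfin] with n hn using integrable_clm_apply hA hC hn
  · have h2 : ∀ n, eLpNorm ((fun y => A y (f n y)) - fun y => A y (g y)) 1 μ ≤
        ENNReal.ofReal C * eLpNorm (fun y => f n y - g y) 1 μ := by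
      intro n
      refine eLpNorm_le_mul_eLpNorm_of_ae_le_mul ?_ 1
      filter_upwards [hC] with y hy
      simpa using (A y).le_of_opNorm_le hy (f n y - g y)
    refine tendsto_of_tendsto_of_tendsto_of_le_of_le tendsto_const_nhds ?_ (fun n => zero_le) h2
    simpa using ENNReal.Tendsto.const_mul h (Or.inr ENNReal.ofReal_ne_top)

end Convergence

/-! ### Gradient pairing, partial derivatives and the Laplacian. -/

variable {d : ℕ}

set_option maxSynthPendingDepth 3 in
/-- The pairing `gradDot` of real covectors as a continuous bilinear map. -/
noncomputable def gradDotL (d : ℕ) : (E d →L[ℝ] ℝ) →L[ℝ] (E d →L[ℝ] ℝ) →L[ℝ] ℝ :=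
  ∑ i : Fin d, (ContinuousLinearMap.mul ℝ ℝ).bilinearComp
    (ContinuousLinearMap.apply ℝ ℝ (EuclideanSpace.single i (1 : ℝ)))
    (ContinuousLinearMap.apply ℝ ℝ (EuclideanSpace.single i (1 : ℝ)))

theorem gradDotL_apply (A B : E d →L[ℝ] ℝ) : gradDotL d A B = gradDot A B := by
  simp [gradDotL, gradDot, mul_comm, _root_.sum_apply]

theorem gradDot_comm (A B : E d →L[ℝ] ℝ) : gradDot A B = gradDot B A := by
  simp [gradDot, mul_comm]

/-- Directional derivative along a coordinate axis. -/
noncomputable def pd (i : Fin d) (f : E d → ℝ) (y : E d) : ℝ :=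
  fderiv ℝ f y (EuclideanSpace.single i 1)

/-- The Laplacian as a sum of second partial derivatives. -/
noncomputable def lap (f : E d → ℝ) (y : E d) : ℝ := ∑ i, pd i (pd i f) y

theorem gradDot_fderiv (A : E d →L[ℝ] ℝ) (f : E d → ℝ) (y : E d) :
    gradDot A (fderiv ℝ f y) = ∑ i, pd i f y * A (EuclideanSpace.single i 1) := rfl

theorem contDiff_pd {m n : ℕ∞ω} {f : E d → ℝ} (hf : ContDiff ℝ n f) (h : m + 1 ≤ n) (i : Fin d) :
    ContDiff ℝ m (pd i f) :=
  (hf.fderiv_right h).clm_apply contDiff_const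

theorem continuous_pd {f : E d → ℝ} (hf : ContDiff ℝ 1 f) (i : Fin d) : Continuous (pd i f) :=
  (contDiff_pd (m := 0) hf (by simp) i).continuous

theorem pd_mul {f g : E d → ℝ} {y : E d} (hf : DifferentiableAt ℝ f y)
    (hg : DifferentiableAt ℝ g y) (i : Fin d) :
    pd i (fun z => f z * g z) y = f y * pd i g y + g y * pd i f y := by
  simp [pd, fderiv_fun_mul hf hg]

theorem pd_sub {f g : E d → ℝ} {y : E d} (hf : DifferentiableAt ℝ f y)
    (hg : DifferentiableAt ℝ g y) (i : Fin d) :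
    pd i (fun z => f z - g z) y = pd i f y - pd i g y := by
  simp [pd, fderiv_fun_sub hf hg]

theorem tsupport_pd_subset (f : E d → ℝ) (i : Fin d) : tsupport (pd i f) ⊆ tsupport f :=
  tsupport_fderiv_apply_subset ℝ _

/-! ### Calculus of `C¹(closure Ω \ P)` and of `W^{1,1}(Ω)`. -/

section Sobolev

variable {Ω : Set (E d)} {F F' : Type*} [NormedAddCommGroup F] [NormedSpace ℝ F]
  [NormedAddCommGroup F'] [NormedSpace ℝ F']

theorem IsC1UpToBoundary.clm_comp {P : Set (E d)} {f : E d → F} (hf : IsC1UpToBoundary Ω P f)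
    (L : F →L[ℝ] F') : IsC1UpToBoundary Ω P fun y => L (f y) := by
  obtain ⟨hc, D, hD, hfD⟩ := hf
  exact ⟨L.continuous.comp_continuousOn hc, fun y => L.comp (D y),
    continuousOn_const.clm_comp hD, fun y hy => L.hasFDerivAt.comp y (hfD y hy)⟩

theorem IsC1UpToBoundary.differentiableAt {P : Set (E d)} {f : E d → F}
    (hf : IsC1UpToBoundary Ω P f) {y : E d} (hy : y ∈ Ω \ P) : DifferentiableAt ℝ f y :=
  (hf.2.choose_spec.2 y hy).differentiableAt

theorem _root_.ContDiff.isC1UpToBoundary {f : E d → F} (hf : ContDiff ℝ 1 f) :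
    IsC1UpToBoundary Ω ∅ f :=
  ⟨hf.continuous.continuousOn, fderiv ℝ f, (hf.continuous_fderiv one_ne_zero).continuousOn,
    fun y _ => (hf.differentiable one_ne_zero y).hasFDerivAt⟩

theorem continuousOn_of_eventuallyEq_zero {X W : Type*} [TopologicalSpace X] [TopologicalSpace W]
    [Zero W] {S P : Set X} (hP : IsClosed P) {g : X → W} (hg : ContinuousOn g (S \ P))
    (h0 : ∀ x ∈ P, g =ᶠ[𝓝 x] 0) : ContinuousOn g S := by
  intro y hy
  by_cases hyP : y ∈ P
  · exact ((continuousAt_const (y := (0 : W))).congr (h0 y hyP).symm).continuousWithinAt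
  · have := hg y ⟨hy, hyP⟩
    rwa [sdiff_eq, continuousWithinAt_inter (hP.isOpen_compl.mem_nhds hyP)] at this

/-- Multiplication by a `C¹` function that vanishes near the singular set removes it. -/
theorem IsC1UpToBoundary.mul_left {P : Set (E d)} (hP : IsClosed P) {f ζ : E d → ℝ}
    (hf : IsC1UpToBoundary Ω P f) (hζ : ContDiff ℝ 1 ζ) (h0 : ∀ x ∈ P, ζ =ᶠ[𝓝 x] 0) :
    IsC1UpToBoundary Ω ∅ fun y => ζ y * f y := by
  obtain ⟨hc, D, hD, hfD⟩ := hf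
  have h0' : ∀ x ∈ P, fderiv ℝ ζ =ᶠ[𝓝 x] 0 := fun x hx => by
    filter_upwards [(h0 x hx).eventuallyEq_nhds] with y hy
    rw [hy.fderiv_eq]; simp
  simp only [IsC1UpToBoundary, sdiff_empty]
  refine ⟨continuousOn_of_eventuallyEq_zero hP (hζ.continuous.continuousOn.mul hc) ?_,
    fun y => ζ y • D y + f y • fderiv ℝ ζ y, continuousOn_of_eventuallyEq_zero hP
      ((hζ.continuous.continuousOn.smul hD).add
        (hc.smul (hζ.continuous_fderiv one_ne_zero).continuousOn)) ?_, ?_⟩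
  · intro x hx
    filter_upwards [h0 x hx] with y hy
    simp [hy]
  · intro x hx
    filter_upwards [h0 x hx, h0' x hx] with y hy hy'
    simp [hy, hy']
  · intro y hy
    by_cases hyP : y ∈ P
    · have h1 : (fun y => ζ y * f y) =ᶠ[𝓝 y] fun _ => 0 := by
        filter_upwards [h0 y hyP] with z hz
        simp [hz]
      have h2 := (h0 y hyP).eq_of_nhds
      have h3 := (h0' y hyP).eq_of_nhds
      simp only [Pi.zero_apply] at h2 h3
      simpa [h2, h3] using (hasFDerivAt_const (0 : ℝ) y).congr_of_eventuallyEq h1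
    · exact (hζ.differentiable one_ne_zero y).hasFDerivAt.mul (hfD y ⟨hy, hyP⟩)

/-- Every approximation error grows at most by the factor `‖L‖`. This reduces the complex potential
to real functions, with `L` the real or the imaginary part. -/
theorem HasW11Grad.clm_comp {u : E d → F} {G : E d → E d →L[ℝ] F} (hu : HasW11Grad Ω u G)
    (hΩ : IsOpen Ω) (L : F →L[ℝ] F') :
    HasW11Grad Ω (fun y => L (u y)) (fun y => L.comp (G y)) := by
  obtain ⟨h1, h2, h3, φ, hφ, ha, hb, hc⟩ := hu
  have key : ∀ {μ : Measure (E d)} {W W' : Type _} [NormedAddCommGroup W] [NormedAddCommGroup W']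
      {f : ℕ → E d → W} {g : ℕ → E d → W'} (_ : ∀ n, ∀ᵐ y ∂μ, ‖g n y‖ ≤ ‖L‖ * ‖f n y‖)
      (_ : Tendsto (fun n => eLpNorm (f n) 1 μ) atTop (𝓝 0)),
      Tendsto (fun n => eLpNorm (g n) 1 μ) atTop (𝓝 0) := by
    intro μ W W' _ _ f g hfg hf
    refine tendsto_of_tendsto_of_tendsto_of_le_of_le tendsto_const_nhds
      (h := fun n => ENNReal.ofReal ‖L‖ * eLpNorm (f n) 1 μ) ?_ (fun n => zero_le)
      (fun n => eLpNorm_le_mul_eLpNorm_of_ae_le_mul (hfg n) 1)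
    simpa using ENNReal.Tendsto.const_mul (a := ENNReal.ofReal ‖L‖) hf (Or.inr ENNReal.ofReal_ne_top)
  refine ⟨L.integrable_comp h1, ?_, L.integrable_comp h3, fun n y => L (φ n y),
    fun n => (hφ n).clm_comp L, key (fun n => ?_) ha, key (fun n => ?_) hb, key (fun n => ?_) hc⟩
  · exact (ContinuousLinearMap.compL ℝ (E d) F F' L).integrable_comp h2
  · exact Eventually.of_forall fun y => by simpa using L.le_opNorm (φ n y - u y)
  · filter_upwards [ae_restrict_mem hΩ.measurableSet] with y hy
    have : fderiv ℝ (fun z => L (φ n z)) y = L.comp (fderiv ℝ (φ n) y) :=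
      (L.hasFDerivAt.comp y ((hφ n).differentiableAt ⟨hy, notMem_empty y⟩).hasFDerivAt).fderiv
    rw [this, ← ContinuousLinearMap.comp_sub]
    exact L.opNorm_comp_le _
  · exact Eventually.of_forall fun y => by simpa using L.le_opNorm (φ n y - u y)

theorem IsC1UpToBoundary.continuousOn_fderiv {P : Set (E d)} {f : E d → F}
    (hf : IsC1UpToBoundary Ω P f) : ContinuousOn (fderiv ℝ f) (Ω \ P) := by
  obtain ⟨-, D, hD, hfD⟩ := hf
  exact (hD.mono (sdiff_subset_sdiff_left subset_closure)).congr fun y hy => (hfD y hy).fderiv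

theorem integrable_mul_of_tsupport_subset (hΩ : IsOpen Ω) {f g : E d → ℝ} (hf : Continuous f)
    (hfc : HasCompactSupport f) (hfΩ : tsupport f ⊆ Ω) (hg : ContinuousOn g Ω) :
    Integrable (fun y => f y * g y) := by
  refine Continuous.integrable_of_hasCompactSupport ?_ hfc.mul_right
  exact (hf.continuousOn.mul hg).continuous_of_tsupport_subset hΩ
    ((tsupport_mul_subset_left (f := f)).trans hfΩ)

set_option maxSynthPendingDepth 3 in
/-- Functions in `W^{1,1}(Ω)` satisfy the divergence theorem against compactly supported `C¹`
vector fields. -/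
theorem HasW11Grad.integral_pd_add {u : E d → ℝ} {G : E d → E d →L[ℝ] ℝ} (hu : HasW11Grad Ω u G)
    (hΩ : IsOpen Ω) {ψ : E d → ℝ} (hψ : ContDiff ℝ 1 ψ) (hψc : HasCompactSupport ψ)
    (hψΩ : tsupport ψ ⊆ Ω) (i : Fin d) :
    Integrable (fun y => u y * pd i ψ y + ψ y * G y (EuclideanSpace.single i 1))
      (volume.restrict Ω) ∧
    ∫ y in Ω, (u y * pd i ψ y + ψ y * G y (EuclideanSpace.single i 1)) = 0 := by
  obtain ⟨h1, h2, -, φ, hφ, ha, hb, -⟩ := hu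
  set e : E d := EuclideanSpace.single i 1 with he
  obtain ⟨C₁, hC₁⟩ := hψ.continuous.bounded_above_of_compact_support hψc
  have hpc : HasCompactSupport (pd i ψ) := hψc.fderiv_apply ℝ e
  obtain ⟨C₂, hC₂⟩ := (continuous_pd hψ i).bounded_above_of_compact_support hpc
  -- Both terms are written as bounded fields of functionals applied to the function and to its
  -- gradient, so that they pass to the `L¹` limit.
  let A₁ : E d → ℝ →L[ℝ] ℝ := fun y => pd i ψ y • ContinuousLinearMap.id ℝ ℝ
  let A₂ : E d → (E d →L[ℝ] ℝ) →L[ℝ] ℝ := fun y => ψ y • ContinuousLinearMap.apply ℝ ℝ e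
  have hA₁ : Continuous A₁ := (continuous_pd hψ i).smul continuous_const
  have hA₂ : Continuous A₂ := hψ.continuous.smul continuous_const
  have hB₁ : ∀ᵐ y ∂(volume.restrict Ω), ‖A₁ y‖ ≤ C₂ * ‖ContinuousLinearMap.id ℝ ℝ‖ :=
    Eventually.of_forall fun y => by
      rw [norm_smul]; exact mul_le_mul_of_nonneg_right (hC₂ y) (norm_nonneg _)
  have hB₂ : ∀ᵐ y ∂(volume.restrict Ω),
      ‖A₂ y‖ ≤ C₁ * ‖(ContinuousLinearMap.apply ℝ ℝ e : (E d →L[ℝ] ℝ) →L[ℝ] ℝ)‖ :=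
    Eventually.of_forall fun y => by
      rw [norm_smul]; exact mul_le_mul_of_nonneg_right (hC₁ y) (norm_nonneg _)
  have hi₁ := integrable_clm_apply hA₁.aestronglyMeasurable hB₁ h1
  have hi₂ := integrable_clm_apply hA₂.aestronglyMeasurable hB₂ h2
  have hφc : ∀ n, ContinuousOn (φ n) Ω := fun n => (hφ n).1.mono (by
    rw [sdiff_empty]; exact subset_closure)
  have ht₁ := tendsto_integral_clm_apply hA₁.aestronglyMeasurable hB₁ h1
    (fun n => (hφc n).aestronglyMeasurable hΩ.measurableSet) ha
  have ht₂ := tendsto_integral_clm_apply hA₂.aestronglyMeasurable hB₂ h2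
    (fun n => (measurable_fderiv ℝ (φ n)).aestronglyMeasurable) hb
  have hzero : ∀ n, (∫ y in Ω, A₁ y (φ n y)) + ∫ y in Ω, A₂ y (fderiv ℝ (φ n) y) = 0 := by
    intro n
    have hφ' : ContinuousOn (fun y => fderiv ℝ (φ n) y e) Ω := by
      have := (hφ n).continuousOn_fderiv
      rw [sdiff_empty] at this
      exact this.clm_apply continuousOn_const
    have hpΩ := (tsupport_pd_subset ψ i).trans hψΩ
    -- Integration by parts runs over the whole space: differentiability of `φ n` is needed only on
    -- the support of `ψ`, which lies in `Ω`.
    have hibp := integral_mul_fderiv_eq_neg_fderiv_mul_of_integrable (μ := volume) (f := ψ)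
      (g := φ n) (v := e)
      (integrable_mul_of_tsupport_subset hΩ (continuous_pd hψ i) hpc hpΩ (hφc n))
      (integrable_mul_of_tsupport_subset hΩ hψ.continuous hψc hψΩ hφ')
      (integrable_mul_of_tsupport_subset hΩ hψ.continuous hψc hψΩ (hφc n))
      (fun y _ => hψ.differentiable one_ne_zero y)
      (fun y hy => (hφ n).differentiableAt ⟨hψΩ hy, notMem_empty y⟩)
    rw [setIntegral_eq_integral_of_forall_compl_eq_zero,
      setIntegral_eq_integral_of_forall_compl_eq_zero]
    · simp only [A₁, A₂, _root_.smul_apply, ContinuousLinearMap.id_apply, smul_eq_mul,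
        ContinuousLinearMap.apply_apply, hibp]
      exact add_neg_cancel _
    · intro y hy
      simp [A₂, image_eq_zero_of_notMem_tsupport fun h => hy (hψΩ h)]
    · intro y hy
      simp [A₁, image_eq_zero_of_notMem_tsupport fun h => hy (hpΩ h)]
  have hadd := ht₁.add ht₂
  simp only [hzero] at hadd
  have hfin := tendsto_nhds_unique hadd tendsto_const_nhds
  rw [← integral_add hi₁ hi₂] at hfin
  have heq : (fun y => A₁ y (u y) + A₂ y (G y)) = fun y => u y * pd i ψ y + ψ y * G y e := by
    ext y; simp [A₁, A₂, mul_comm]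
  rw [heq] at hfin
  exact ⟨heq ▸ hi₁.add hi₂, hfin⟩

end Sobolev

/-! ### Derivatives of convolutions. -/

theorem pd_convolution {θ g : E d → ℝ} (hθ : ContDiff ℝ 1 θ) (hθc : HasCompactSupport θ)
    (hg : LocallyIntegrable g) (i : Fin d) :
    pd i (θ ⋆[ContinuousLinearMap.lsmul ℝ ℝ] g) =
      (pd i θ ⋆[ContinuousLinearMap.lsmul ℝ ℝ] g) := by
  ext y
  have hint := (hθc.fderiv ℝ).convolutionExists_left
    ((ContinuousLinearMap.lsmul ℝ ℝ : ℝ →L[ℝ] ℝ →L[ℝ] ℝ).precompL (E d))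
    (hθ.continuous_fderiv one_ne_zero) hg y
  rw [pd, (hθc.hasFDerivAt_convolution_left _ hθ hg y).fderiv, convolution, convolution,
    ContinuousLinearMap.integral_apply hint.integrable]
  rfl

/-- The Laplacian of a convolution, as an integral against the Laplacian of a reflected kernel. -/
theorem lap_convolution {θ g : E d → ℝ} (hθ : ContDiff ℝ ∞ θ) (hθc : HasCompactSupport θ)
    (hg : LocallyIntegrable g) (y : E d) :
    lap (θ ⋆[ContinuousLinearMap.lsmul ℝ ℝ] g) y = ∫ t, g t * lap (fun s => θ (y - s)) t := by
  have h1 : ∀ i, ContDiff ℝ ∞ (pd i θ) := fun i => contDiff_pd hθ le_rfl i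
  have hc1 : ∀ i, HasCompactSupport (pd i θ) := fun i => hθc.fderiv_apply ℝ _
  have h2 : ∀ i, ContDiff ℝ ∞ (pd i (pd i θ)) := fun i => contDiff_pd (h1 i) le_rfl i
  have hc2 : ∀ i, HasCompactSupport (pd i (pd i θ)) := fun i => (hc1 i).fderiv_apply ℝ _
  have hrefl : ∀ {η : E d → ℝ} (_ : ContDiff ℝ ∞ η) (i : Fin d),
      pd i (fun s => η (y - s)) = fun s => - pd i η (y - s) := by
    intro η hη i
    ext s
    have := ((hη.differentiable (by simp) (y - s)).hasFDerivAt.comp s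
      ((hasFDerivAt_id s).const_sub y)).fderiv
    simp only [Function.comp_def] at this
    simp [pd, this]
  have hlap : ∀ t, lap (fun s => θ (y - s)) t = ∑ i, pd i (pd i θ) (y - t) := by
    intro t
    refine Finset.sum_congr rfl fun i _ => ?_
    rw [hrefl hθ i]
    -- The second reflection brings a second minus sign, which cancels the first.
    have : (fun s => - pd i θ (y - s)) = fun s => (-pd i θ) (y - s) := rfl
    rw [this, hrefl (η := -pd i θ) (h1 i).neg i]
    simp [pd, fderiv_neg]
  simp only [hlap, Finset.mul_sum]
  rw [integral_finsetSum]
  · refine Finset.sum_congr rfl fun i _ => ?_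
    rw [pd_convolution (hθ.of_le (by simp)) hθc hg, pd_convolution ((h1 i).of_le (by simp))
      (hc1 i) hg, convolution_eq_swap]
    simp [mul_comm]
  · intro i _
    have := ((hc2 i).convolutionExists_left (ContinuousLinearMap.lsmul ℝ ℝ : ℝ →L[ℝ] ℝ →L[ℝ] ℝ)
      (h2 i).continuous hg y).integrable_swap
    simpa [mul_comm] using this

/-! ### Reproducing kernels for harmonic functions. -/

section Sobolev

variable {Ω : Set (E d)}

theorem HasW11Grad.integral_div {u : E d → ℝ} {G : E d → E d →L[ℝ] ℝ} (hu : HasW11Grad Ω u G)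
    (hΩ : IsOpen Ω) {ψ : Fin d → E d → ℝ} (hψ : ∀ i, ContDiff ℝ 1 (ψ i))
    (hψc : ∀ i, HasCompactSupport (ψ i)) (hψΩ : ∀ i, tsupport (ψ i) ⊆ Ω) :
    Integrable (fun y => ∑ i, (u y * pd i (ψ i) y + ψ i y * G y (EuclideanSpace.single i 1)))
      (volume.restrict Ω) ∧
    ∫ y in Ω, ∑ i, (u y * pd i (ψ i) y + ψ i y * G y (EuclideanSpace.single i 1)) = 0 := by
  have h := fun i => hu.integral_pd_add hΩ (hψ i) (hψc i) (hψΩ i) i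
  refine ⟨integrable_finsetSum _ fun i _ => (h i).1, ?_⟩
  rw [integral_finsetSum _ fun i _ => (h i).1]
  exact Finset.sum_eq_zero fun i _ => (h i).2

theorem continuous_lap {f : E d → ℝ} (hf : ContDiff ℝ 2 f) : Continuous (lap f) :=
  continuous_finsetSum _ fun _ _ => continuous_pd (contDiff_pd hf (by norm_num) _) _

theorem lap_eq_zero_of_notMem_tsupport {f : E d → ℝ} {y : E d} (hy : y ∉ tsupport f) :
    lap f y = 0 :=
  Finset.sum_eq_zero fun _ _ => image_eq_zero_of_notMem_tsupport fun h =>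
    hy (tsupport_pd_subset _ _ (tsupport_pd_subset _ _ h))

/-- A weak solution of the Laplace equation is a distributional solution. -/
theorem HasW11Grad.integral_mul_lap_eq_zero {u : E d → ℝ} {G : E d → E d →L[ℝ] ℝ}
    (hu : HasW11Grad Ω u G) (hΩ : IsOpen Ω) {ψ : E d → ℝ} (hψ : ContDiff ℝ 2 ψ)
    (hψc : HasCompactSupport ψ) (hψΩ : tsupport ψ ⊆ Ω)
    (hw : ∫ y in Ω, gradDot (G y) (fderiv ℝ ψ y) = 0) :
    ∫ y in Ω, u y * lap ψ y = 0 := by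
  have hp1 : ∀ i, ContDiff ℝ 1 (pd i ψ) := fun i => contDiff_pd hψ (by norm_num) i
  obtain ⟨hi, hz⟩ := hu.integral_div hΩ hp1
    (fun _ => hψc.fderiv_apply ℝ _) (fun i => (tsupport_pd_subset ψ i).trans hψΩ)
  have hlc : HasCompactSupport (lap ψ) := HasCompactSupport.intro hψc fun y hy =>
    lap_eq_zero_of_notMem_tsupport hy
  obtain ⟨C, hC⟩ := (continuous_lap hψ).bounded_above_of_compact_support hlc
  have hi' : Integrable (fun y => u y * lap ψ y) (volume.restrict Ω) :=
    hu.integrable.mul_bdd (continuous_lap hψ).aestronglyMeasurable (Eventually.of_forall hC)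
  have heq : ∀ y, gradDot (G y) (fderiv ℝ ψ y) =
      (∑ i, (u y * pd i (pd i ψ) y + pd i ψ y * G y (EuclideanSpace.single i 1))) -
        u y * lap ψ y := by
    intro y
    rw [Finset.sum_add_distrib, gradDot_fderiv, lap, Finset.mul_sum]; ring
  simp only [heq] at hw
  rw [integral_sub hi hi', hz] at hw
  linarith

/-- The function which represents point evaluation of harmonic functions, in terms of a function
`f` with a pole of Newtonian type and a cutoff function `χ` around the pole. -/
noncomputable def reprKernel (f χ : E d → ℝ) (y : E d) : ℝ :=
  2 * gradDot (fderiv ℝ f y) (fderiv ℝ χ y) + f y * lap χ y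

theorem tsupport_reprKernel_subset (f χ : E d → ℝ) : tsupport (reprKernel f χ) ⊆ tsupport χ := by
  refine closure_minimal (fun y hy => ?_) (isClosed_tsupport χ)
  by_contra h
  refine hy ?_
  have : fderiv ℝ χ y = 0 :=
    image_eq_zero_of_notMem_tsupport fun h' => h (tsupport_fderiv_subset ℝ h')
  simp [reprKernel, lap_eq_zero_of_notMem_tsupport h, this, gradDot]

theorem _root_.ContinuousOn.gradDot {S : Set (E d)} {A B : E d → E d →L[ℝ] ℝ}
    (hA : ContinuousOn A S) (hB : ContinuousOn B S) :
    ContinuousOn (fun y => gradDot (A y) (B y)) S :=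
  continuousOn_finsetSum _ fun _ _ =>
    (hB.clm_apply continuousOn_const).smul (hA.clm_apply continuousOn_const)

theorem fderiv_eventuallyEq_zero {χ : E d → ℝ} {x : E d} {a : ℝ} (h : χ =ᶠ[𝓝 x] fun _ => a) :
    fderiv ℝ χ =ᶠ[𝓝 x] 0 := by
  filter_upwards [h.eventuallyEq_nhds] with y hy
  rw [hy.fderiv_eq]; simp

theorem pd_eventuallyEq_zero {χ : E d → ℝ} {x : E d} {a : ℝ} (h : χ =ᶠ[𝓝 x] fun _ => a)
    (i : Fin d) : pd i χ =ᶠ[𝓝 x] fun _ => 0 := by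
  filter_upwards [fderiv_eventuallyEq_zero h] with y hy
  simp [pd, hy]

/-- Every term contains a derivative of `χ`. These vanish near the pole, where `χ` is constant, and
off the pole `f` is `C¹`. -/
theorem continuous_reprKernel {f χ : E d → ℝ} {x : E d} (hΩ : IsOpen Ω)
    (hf : IsC1UpToBoundary Ω {x} f) (hχ : ContDiff ℝ ∞ χ) (hχ1 : χ =ᶠ[𝓝 x] fun _ => 1)
    (hχΩ : tsupport χ ⊆ Ω) : Continuous (reprKernel f χ) := by
  refine ContinuousOn.continuous_of_tsupport_subset (s := Ω) ?_ hΩ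
    ((tsupport_reprKernel_subset f χ).trans hχΩ)
  refine continuousOn_of_eventuallyEq_zero (P := {x}) isClosed_singleton ?_ ?_
  · exact (continuousOn_const.mul (hf.continuousOn_fderiv.gradDot
      (hχ.continuous_fderiv (by simp)).continuousOn)).add
      ((hf.1.mono (sdiff_subset_sdiff_left subset_closure)).mul
        (continuous_lap (by exact_mod_cast contDiff_infty.1 hχ 2)).continuousOn)
  · rintro z rfl
    have h2 : ∀ᶠ y in 𝓝 z, ∀ i, pd i (pd i χ) y = 0 :=
      eventually_all.2 fun i => pd_eventuallyEq_zero (pd_eventuallyEq_zero hχ1 i) i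
    filter_upwards [fderiv_eventuallyEq_zero hχ1, h2] with y h1 h2
    simp [reprKernel, h1, h2, gradDot, lap]

/-- Green's formula for a harmonic function and a function with a pole at `x`. -/
theorem eq_integral_mul_reprKernel {f χ v : E d → ℝ} {x : E d} {c : ℝ} (hΩ : IsOpen Ω)
    (hf : HasW11Grad Ω f (fderiv ℝ f))
    (hfw : ∀ φ : E d → ℝ, IsC1UpToBoundary Ω ∅ φ →
      ∫ y in Ω, gradDot (fderiv ℝ f y) (fderiv ℝ φ y) =
        φ x - c * ∫ y, φ y ∂(surfaceMeasure Ω))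
    (hχ : ContDiff ℝ ∞ χ) (hχx : χ x = 1) (hχc : HasCompactSupport χ) (hχΩ : tsupport χ ⊆ Ω)
    (hv : ContDiff ℝ ∞ v) (hvl : ∀ y ∈ tsupport χ, lap v y = 0)
    (hb : Continuous (reprKernel f χ)) :
    v x = ∫ y in Ω, v y * reprKernel f χ y := by
  have hpχ : ∀ i, ContDiff ℝ ∞ (pd i χ) := fun i => contDiff_pd hχ le_rfl i
  have hpv : ∀ i, ContDiff ℝ ∞ (pd i v) := fun i => contDiff_pd hv le_rfl i
  have h1 : ∀ {g : E d → ℝ}, ContDiff ℝ ∞ g → ∀ y, DifferentiableAt ℝ g y :=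
    fun hg y => hg.differentiable (by simp) y
  -- Green's field `χ ∇v - v ∇χ`: since `v` is harmonic on the support of `χ`, its divergence is `-v
  -- Δχ`. The divergence theorem for `f` with this field turns the test of its equation against `χ
  -- v` into the kernel integral.
  let ψ : Fin d → E d → ℝ := fun i y => χ y * pd i v y - v y * pd i χ y
  have hψ : ∀ i, ContDiff ℝ ∞ (ψ i) := fun i => (hχ.mul (hpv i)).sub (hv.mul (hpχ i))
  have hψs : ∀ i, tsupport (ψ i) ⊆ tsupport χ := by
    intro i
    refine closure_minimal (fun y hy => ?_) (isClosed_tsupport χ)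
    by_contra h
    exact hy (by
      simp [ψ, image_eq_zero_of_notMem_tsupport h,
        image_eq_zero_of_notMem_tsupport fun h' => h (tsupport_pd_subset χ i h')])
  obtain ⟨hi, hz⟩ := hf.integral_div hΩ (fun i => (hψ i).of_le (by simp))
    (fun i => hχc.of_isClosed_subset (isClosed_tsupport _) (hψs i)) (fun i => (hψs i).trans hχΩ)
  have hbs : HasCompactSupport (reprKernel f χ) :=
    hχc.of_isClosed_subset (isClosed_tsupport _) (tsupport_reprKernel_subset f χ)
  have hib : Integrable (fun y => v y * reprKernel f χ y) :=
    (hv.continuous.mul hb).integrable_of_hasCompactSupport hbs.mul_left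
  have htest := hfw (fun y => χ y * v y) ((hχ.mul hv).of_le (by simp)).isC1UpToBoundary
  have hbd : ∫ y, χ y * v y ∂(surfaceMeasure Ω) = 0 := by
    refine setIntegral_eq_zero_of_forall_eq_zero fun y hy => ?_
    have : y ∉ tsupport χ := fun h => by
      rw [hΩ.frontier_eq] at hy; exact hy.2 (hχΩ h)
    simp [image_eq_zero_of_notMem_tsupport this]
  rw [hbd, hχx, mul_zero, sub_zero, one_mul] at htest
  rw [← htest, ← add_zero (∫ y in Ω, v y * reprKernel f χ y), ← hz,
    ← integral_add hib.integrableOn hi]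
  refine setIntegral_congr_fun hΩ.measurableSet fun y _ => ?_
  have hpψ : ∀ i, pd i (ψ i) y = χ y * pd i (pd i v) y - v y * pd i (pd i χ) y := by
    intro i
    refine (pd_sub (f := fun z => χ z * pd i v z) (g := fun z => v z * pd i χ z)
      ((h1 hχ y).mul (h1 (hpv i) y)) ((h1 hv y).mul (h1 (hpχ i) y)) i).trans ?_
    rw [pd_mul (h1 hχ y) (h1 (hpv i) y), pd_mul (h1 hv y) (h1 (hpχ i) y)]
    ring
  have hlapv : χ y * ∑ i, pd i (pd i v) y = 0 := by
    by_cases hy : y ∈ tsupport χ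
    · rw [show ∑ i, pd i (pd i v) y = lap v y from rfl, hvl y hy, mul_zero]
    · rw [image_eq_zero_of_notMem_tsupport hy, zero_mul]
  have hsum : ∑ i, (f y * pd i (ψ i) y + ψ i y * fderiv ℝ f y (EuclideanSpace.single i 1)) =
      f y * (χ y * ∑ i, pd i (pd i v) y) - f y * v y * lap χ y +
        χ y * gradDot (fderiv ℝ f y) (fderiv ℝ v y) -
        v y * gradDot (fderiv ℝ f y) (fderiv ℝ χ y) := by
    simp only [hpψ, gradDot_fderiv, lap, Finset.mul_sum, ψ, ← Finset.sum_add_distrib,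
      ← Finset.sum_sub_distrib]
    exact Finset.sum_congr rfl fun i _ => by ring
  have hD : gradDot (fderiv ℝ f y) (fderiv ℝ (fun z => χ z * v z) y) =
      χ y * gradDot (fderiv ℝ f y) (fderiv ℝ v y) +
        v y * gradDot (fderiv ℝ f y) (fderiv ℝ χ y) := by
    simp only [gradDot_fderiv, pd_mul (h1 hχ y) (h1 hv y), Finset.mul_sum,
      ← Finset.sum_add_distrib]
    exact Finset.sum_congr rfl fun i _ => by ring
  simp only [hsum, hD, hlapv, reprKernel]
  ring

/-- A continuous distributional solution of the Laplace equation is represented by any kernel that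
represents the smooth ones. -/
theorem eq_integral_mul_of_weakly_harmonic {u b : E d → ℝ} {x : E d} {r R : ℝ} (hr : 0 ≤ r)
    (hrR : r < R)
    (hΩ : IsOpen Ω) (hRΩ : Metric.closedBall x R ⊆ Ω) (hu : IntegrableOn u Ω)
    (huc : ContinuousOn u (Metric.closedBall x R))
    (hul : ∀ ψ : E d → ℝ, ContDiff ℝ ∞ ψ → tsupport ψ ⊆ Metric.closedBall x R →
      ∫ y in Ω, u y * lap ψ y = 0)
    (hb : Continuous b) (hbc : tsupport b ⊆ Metric.closedBall x r)
    (hrep : ∀ v : E d → ℝ, ContDiff ℝ ∞ v → (∀ y ∈ Metric.closedBall x r, lap v y = 0) →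
      v x = ∫ y in Ω, v y * b y) :
    u x = ∫ y in Ω, u y * b y := by
  have hbc' : HasCompactSupport b :=
    (isCompact_closedBall x r).of_isClosed_subset (isClosed_tsupport b) hbc
  set g : E d → ℝ := Ω.indicator u with hg
  have hgi : Integrable g := (integrable_indicator_iff hΩ.measurableSet).2 hu
  have hgu : ∀ y ∈ Metric.closedBall x R, g y = u y := fun y hy =>
    indicator_of_mem (hRΩ hy) u
  -- The outer radii tend to `0` and never exceed `R - r`, so mollifying at a point of the ball of
  -- radius `r` uses `u` only in the ball of radius `R`.
  let η : ℕ → ContDiffBump (0 : E d) := fun n =>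
    ⟨(R - r) / (n + 1) / 2, (R - r) / (n + 1), by
      have : 0 < R - r := by linarith
      positivity, half_lt_self (by have : 0 < R - r := by linarith
                                   positivity)⟩
  have hηr : ∀ n, (η n).rOut ≤ R - r := fun n =>
    div_le_self (by linarith) (by linarith [n.cast_nonneg (α := ℝ)])
  have hη0 : Tendsto (fun n => (η n).rOut) atTop (𝓝 0) :=
    tendsto_const_nhds.div_atTop (tendsto_atTop_add_const_right _ _ tendsto_natCast_atTop_atTop)
  let v : ℕ → E d → ℝ := fun n =>
    ((η n).normed volume ⋆[ContinuousLinearMap.lsmul ℝ ℝ] g)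
  have hv : ∀ n, ContDiff ℝ ∞ (v n) := fun n =>
    (η n).hasCompactSupport_normed.contDiff_convolution_left _ (η n).contDiff_normed
      hgi.locallyIntegrable
  have hball : ∀ n, ∀ y ∈ Metric.closedBall x r, Metric.closedBall y (η n).rOut ⊆
      Metric.closedBall x R := fun n y hy =>
    Metric.closedBall_subset_closedBall' (by
      have := hηr n; rw [Metric.mem_closedBall] at hy; linarith)
  have hvl : ∀ n, ∀ y ∈ Metric.closedBall x r, lap (v n) y = 0 := by
    intro n y hy
    rw [lap_convolution (η n).contDiff_normed (η n).hasCompactSupport_normed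
      hgi.locallyIntegrable]
    -- The reflected and translated mollifier is itself an admissible test function for the weak
    -- harmonicity of `u`.
    have hψ := hul (fun s => (η n).normed volume (y - s))
      ((η n).contDiff_normed.comp (contDiff_const.sub contDiff_id)) ?_
    · rw [← hψ, ← integral_indicator hΩ.measurableSet]
      refine integral_congr_ae (Eventually.of_forall fun t => ?_)
      by_cases ht : t ∈ Ω <;> simp [hg, ht]
    · refine Subset.trans ?_ (hball n y hy)
      refine closure_minimal (fun s hs => ?_) Metric.isClosed_closedBall
      have : y - s ∈ Function.support ((η n).normed volume) := hs
      rw [(η n).support_normed_eq, mem_ball_zero_iff] at this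
      rw [Metric.mem_closedBall, dist_comm, dist_eq_norm]
      exact this.le
  obtain ⟨M, hM⟩ := (isCompact_closedBall x R).exists_bound_of_continuousOn huc
  have hM0 : 0 ≤ M := (norm_nonneg _).trans
    (hM x (Metric.mem_closedBall_self (by linarith)))
  -- The uniform bound supplies the majorant for dominated convergence on the support of `b`.
  have hvM : ∀ n, ∀ y ∈ Metric.closedBall x r, ‖v n y‖ ≤ M := by
    intro n y hy
    rw [← dist_zero_right]
    refine dist_convolution_le hM0 (η n).support_normed_eq.subset (η n).nonneg_normed
      (η n).integral_normed hgi.1 fun z hz => ?_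
    have hz' := hball n y hy (Metric.ball_subset_closedBall hz)
    rw [hgu z hz', dist_zero_right]
    exact hM z hz'
  have hlim : ∀ y ∈ Metric.closedBall x r, Tendsto (fun n => v n y) atTop (𝓝 (u y)) := by
    intro y hy
    have hyR : y ∈ Metric.ball x R := Metric.closedBall_subset_ball hrR hy
    have hgc : ContinuousAt g y := by
      have h1 : ContinuousAt u y :=
        huc.continuousAt (mem_of_superset (Metric.isOpen_ball.mem_nhds hyR)
          Metric.ball_subset_closedBall)
      refine h1.congr ?_
      filter_upwards [Metric.isOpen_ball.mem_nhds hyR] with z hz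
      exact (hgu z (Metric.ball_subset_closedBall hz)).symm
    rw [← hgu y (Metric.ball_subset_closedBall hyR)]
    exact ContDiffBump.convolution_tendsto_right hη0
      (Eventually.of_forall fun _ => hgi.1) (hgc.tendsto.comp tendsto_snd) tendsto_const_nhds
  have hint : Tendsto (fun n => ∫ y in Ω, v n y * b y) atTop (𝓝 (∫ y in Ω, u y * b y)) := by
    have hb0 : ∀ y, y ∉ Metric.closedBall x r → b y = 0 := fun y hy =>
      image_eq_zero_of_notMem_tsupport fun h => hy (hbc h)
    refine tendsto_integral_of_dominated_convergence (fun y => M * ‖b y‖)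
      (fun n => ((hv n).continuous.mul hb).aestronglyMeasurable)
      ((hb.integrable_of_hasCompactSupport hbc').norm.const_mul M).integrableOn
      (fun n => Eventually.of_forall fun y => ?_) (Eventually.of_forall fun y => ?_)
    · by_cases hy : y ∈ Metric.closedBall x r
      · rw [norm_mul]; exact mul_le_mul_of_nonneg_right (hvM n y hy) (norm_nonneg _)
      · simp [hb0 y hy]
    · by_cases hy : y ∈ Metric.closedBall x r
      · exact (hlim y hy).mul_const _
      · simp [hb0 y hy]
  have hx := hlim x (Metric.mem_closedBall_self hr)
  simp only [fun n => hrep (v n) (hv n) (hvl n)] at hx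
  exact tendsto_nhds_unique hx hint

end Sobolev

/-! ### Testing with functions cut off near a pole. -/

variable {Ω : Set (E d)}

/-- The gradient of a `C¹` function off a singular set is bounded after pairing with a factor that
vanishes near that set. -/
theorem IsC1UpToBoundary.exists_bound_fderiv_pairing {W W' : Type*} [NormedAddCommGroup W]
    [NormedSpace ℝ W] [NormedAddCommGroup W'] (hb : Bornology.IsBounded Ω)
    {P : Set (E d)} (hP : IsClosed P) {f : E d → ℝ} (hf : IsC1UpToBoundary Ω P f)
    {ζ : E d → W} (hζ : Continuous ζ) (h0 : ∀ x ∈ P, ζ =ᶠ[𝓝 x] 0)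
    {B : (E d →L[ℝ] ℝ) → W → W'} (hB : Continuous fun p : (E d →L[ℝ] ℝ) × W => B p.1 p.2)
    (hB0 : ∀ A, B A 0 = 0) :
    ∃ C, ∀ y ∈ Ω, ‖B (fderiv ℝ f y) (ζ y)‖ ≤ C := by
  obtain ⟨-, D, hD, hfD⟩ := hf
  have hc : ContinuousOn (fun y => B (D y) (ζ y)) (closure Ω) := by
    refine continuousOn_of_eventuallyEq_zero hP
      (hB.comp_continuousOn (hD.prodMk hζ.continuousOn)) fun x hx => ?_
    filter_upwards [h0 x hx] with y hy
    simp [hy, hB0]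
  obtain ⟨C, hC⟩ := hb.isCompact_closure.exists_bound_of_continuousOn hc
  refine ⟨C, fun y hy => ?_⟩
  by_cases hyP : y ∈ P
  · have := hC y (subset_closure hy)
    rw [(h0 y hyP).eq_of_nhds] at this ⊢
    simpa [hB0] using this
  · rw [(hfD y ⟨hy, hyP⟩).fderiv]
    exact hC y (subset_closure hy)

theorem gradDot_fderiv_mul {A : E d →L[ℝ] ℝ} {g h : E d → ℝ} {y : E d}
    (hg : DifferentiableAt ℝ g y) (hh : DifferentiableAt ℝ h y) :
    gradDot A (fderiv ℝ (fun z => g z * h z) y) =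
      g y * gradDot A (fderiv ℝ h y) + h y * gradDot A (fderiv ℝ g y) := by
  simp only [gradDot_fderiv, pd_mul hg hh, Finset.mul_sum, ← Finset.sum_add_distrib]
  exact Finset.sum_congr rfl fun i _ => by ring

set_option maxSynthPendingDepth 3 in
/-- The weak equation for a function with a pole at `x` extends to test functions in `W^{1,1}` that
are cut off near `x`. -/
theorem HasW11Grad.integral_cutoff {f ζ u : E d → ℝ} {G : E d → E d →L[ℝ] ℝ} {x : E d} {c : ℝ}
    (hu : HasW11Grad Ω u G) (hΩ : IsOpen Ω) (hΩb : Bornology.IsBounded Ω)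
    (hf : IsC1UpToBoundary Ω {x} f)
    (hfw : ∀ φ : E d → ℝ, IsC1UpToBoundary Ω ∅ φ →
      ∫ y in Ω, gradDot (fderiv ℝ f y) (fderiv ℝ φ y) =
        φ x - c * ∫ y, φ y ∂(surfaceMeasure Ω))
    (hζ : ContDiff ℝ 1 ζ) (hζx : ζ =ᶠ[𝓝 x] fun _ => 0) (hζΩ : ∀ y ∈ frontier Ω, ζ y = 1) :
    Integrable (fun y => ζ y * gradDot (fderiv ℝ f y) (G y) +
        u y * gradDot (fderiv ℝ f y) (fderiv ℝ ζ y)) (volume.restrict Ω) ∧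
    ∫ y in Ω, (ζ y * gradDot (fderiv ℝ f y) (G y) +
        u y * gradDot (fderiv ℝ f y) (fderiv ℝ ζ y)) = - (c * ∫ y, u y ∂(surfaceMeasure Ω)) := by
  obtain ⟨h1, h2, h3, φ, hφ, ha, hb, hc⟩ := hu
  have hζ' := hζ.continuous_fderiv one_ne_zero
  let A₁ : E d → ℝ →L[ℝ] ℝ := fun y =>
    gradDotL d (fderiv ℝ f y) (fderiv ℝ ζ y) • ContinuousLinearMap.id ℝ ℝ
  let A₂ : E d → (E d →L[ℝ] ℝ) →L[ℝ] ℝ := fun y => ζ y • gradDotL d (fderiv ℝ f y)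
  have hgc : Continuous fun p : (E d →L[ℝ] ℝ) × (E d →L[ℝ] ℝ) => gradDotL d p.1 p.2 :=
    (gradDotL d).continuous₂
  have hfm : AEStronglyMeasurable (fderiv ℝ f) (volume.restrict Ω) :=
    (measurable_fderiv ℝ f).aestronglyMeasurable
  have hm₁ : AEStronglyMeasurable A₁ (volume.restrict Ω) :=
    (hgc.comp_aestronglyMeasurable (hfm.prodMk hζ'.aestronglyMeasurable)).smul
      aestronglyMeasurable_const
  have hm₂ : AEStronglyMeasurable A₂ (volume.restrict Ω) :=
    hζ.continuous.aestronglyMeasurable.smul ((gradDotL d).continuous.comp_aestronglyMeasurable hfm)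
  obtain ⟨C₁, hC₁⟩ := hf.exists_bound_fderiv_pairing hΩb isClosed_singleton hζ'
    (by rintro z rfl; exact fderiv_eventuallyEq_zero hζx)
    (B := fun A B => gradDotL d A B • ContinuousLinearMap.id ℝ ℝ)
    (hgc.smul continuous_const) (by simp)
  obtain ⟨C₂, hC₂⟩ := hf.exists_bound_fderiv_pairing hΩb isClosed_singleton hζ.continuous
    (by rintro z rfl; exact hζx) (B := fun A s => s • gradDotL d A)
    (continuous_snd.smul ((gradDotL d).continuous.comp continuous_fst)) (by simp)
  have hB₁ : ∀ᵐ y ∂(volume.restrict Ω), ‖A₁ y‖ ≤ C₁ := by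
    filter_upwards [ae_restrict_mem hΩ.measurableSet] with y hy using hC₁ y hy
  have hB₂ : ∀ᵐ y ∂(volume.restrict Ω), ‖A₂ y‖ ≤ C₂ := by
    filter_upwards [ae_restrict_mem hΩ.measurableSet] with y hy using hC₂ y hy
  have hmφ : ∀ n, AEStronglyMeasurable (φ n) (volume.restrict Ω) := fun n =>
    ((hφ n).1.mono (by rw [sdiff_empty]; exact subset_closure)).aestronglyMeasurable
      hΩ.measurableSet
  have hmφ' : ∀ n, AEStronglyMeasurable (fderiv ℝ (φ n)) (volume.restrict Ω) := fun n =>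
    (measurable_fderiv ℝ (φ n)).aestronglyMeasurable
  have hmφ'' : ∀ n, AEStronglyMeasurable (φ n) (surfaceMeasure Ω) := fun n =>
    ((hφ n).1.mono (by rw [sdiff_empty]; exact frontier_subset_closure)).aestronglyMeasurable
      isClosed_frontier.measurableSet
  have ht₁ := tendsto_integral_clm_apply hm₁ hB₁ h1 hmφ ha
  have ht₂ := tendsto_integral_clm_apply hm₂ hB₂ h2 hmφ' hb
  have ht₃ := tendsto_integral_of_L1' u h3.1
    (eventually_integrable_of_tendsto_eLpNorm h3 hmφ'' hc) hc
  have hi₁ := integrable_clm_apply hm₁ hB₁ h1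
  have hi₂ := integrable_clm_apply hm₂ hB₂ h2
  have hev : ∀ᶠ n in atTop, (∫ y in Ω, A₂ y (fderiv ℝ (φ n) y)) + ∫ y in Ω, A₁ y (φ n y) =
      - (c * ∫ y, φ n y ∂(surfaceMeasure Ω)) := by
    filter_upwards [eventually_integrable_of_tendsto_eLpNorm h1 hmφ ha,
      eventually_integrable_of_tendsto_eLpNorm h2 hmφ' hb] with n hn hn'
    -- Since `ζ` vanishes at `x` and is `1` on the boundary, testing with `ζ * φ n` drops the point
    -- evaluation and leaves the boundary integral of `φ n`.
    have htest := hfw (fun y => ζ y * φ n y)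
      ((hφ n).mul_left isClosed_empty hζ fun y hy => absurd hy (notMem_empty y))
    have hbd : ∫ y, ζ y * φ n y ∂(surfaceMeasure Ω) = ∫ y, φ n y ∂(surfaceMeasure Ω) :=
      setIntegral_congr_fun isClosed_frontier.measurableSet fun y hy => by
        simp [hζΩ y hy]
    rw [hbd, hζx.eq_of_nhds, zero_mul, zero_sub] at htest
    rw [← htest, ← integral_add (integrable_clm_apply hm₂ hB₂ hn')
      (integrable_clm_apply hm₁ hB₁ hn)]
    refine setIntegral_congr_fun hΩ.measurableSet fun y hy => ?_
    have := gradDot_fderiv_mul (A := fderiv ℝ f y) (hζ.differentiable one_ne_zero y)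
      ((hφ n).differentiableAt ⟨hy, notMem_empty y⟩)
    simp only [this]
    simp [A₁, A₂, gradDotL_apply, mul_comm]
  have hlim := tendsto_nhds_unique ((ht₂.add ht₁).congr' hev) (ht₃.const_mul c).neg
  rw [← integral_add hi₂ hi₁] at hlim
  have heq : (fun y => A₂ y (G y) + A₁ y (u y)) = fun y =>
      ζ y * gradDot (fderiv ℝ f y) (G y) + u y * gradDot (fderiv ℝ f y) (fderiv ℝ ζ y) := by
    ext y; simp [A₁, A₂, gradDotL_apply, mul_comm]
  rw [heq] at hlim
  exact ⟨heq ▸ hi₂.add hi₁, hlim⟩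

/-- Each point either lies in the open set `Ω \ P`, where `f` is `C¹`, or has a neighbourhood on
which `η` vanishes. -/
theorem IsC1UpToBoundary.contDiff_mul {P : Set (E d)} (hΩ : IsOpen Ω) (hP : IsClosed P)
    {f η : E d → ℝ} (hf : IsC1UpToBoundary Ω P f) (hη : ContDiff ℝ 1 η) (hηΩ : tsupport η ⊆ Ω)
    (h0 : ∀ x ∈ P, η =ᶠ[𝓝 x] 0) : ContDiff ℝ 1 fun y => f y * η y := by
  rw [contDiff_iff_contDiffAt]
  intro y
  have hz : η =ᶠ[𝓝 y] 0 → ContDiffAt ℝ 1 (fun y => f y * η y) y := fun h =>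
    (contDiffAt_const (c := (0 : ℝ))).congr_of_eventuallyEq (by
      filter_upwards [h] with z hz
      simp [hz])
  by_cases hy : y ∈ tsupport η
  · by_cases hyP : y ∈ P
    · exact hz (h0 y hyP)
    · have ho : IsOpen (Ω \ P) := hΩ.sdiff hP
      have h1 : ContDiffOn ℝ 1 f (Ω \ P) := by
        rw [← zero_add 1, contDiffOn_succ_iff_fderiv_of_isOpen ho, contDiffOn_zero]
        exact ⟨fun z hz => (hf.differentiableAt hz).differentiableWithinAt, by simp,
          hf.continuousOn_fderiv⟩
      exact (h1.contDiffAt (ho.mem_nhds ⟨hηΩ hy, hyP⟩)).mul hη.contDiffAt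
  · exact hz (notMem_tsupport_iff_eventuallyEq.1 hy)

/-- Green's representation of a harmonic function by a function with a pole at `x`: the value at
the pole is the weak pairing with the part of the latter off the pole. -/
theorem HasW11Grad.eq_integral_gradDot {f χ u : E d → ℝ} {G : E d → E d →L[ℝ] ℝ} {x : E d}
    {c r R : ℝ} (hu : HasW11Grad Ω u G) (hΩ : IsOpen Ω) (hΩb : Bornology.IsBounded Ω)
    (hf : IsC1UpToBoundary Ω {x} f) (hfW : HasW11Grad Ω f (fderiv ℝ f))
    (hfw : ∀ φ : E d → ℝ, IsC1UpToBoundary Ω ∅ φ →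
      ∫ y in Ω, gradDot (fderiv ℝ f y) (fderiv ℝ φ y) =
        φ x - c * ∫ y, φ y ∂(surfaceMeasure Ω))
    (hr : 0 ≤ r) (hrR : r < R) (hRΩ : Metric.closedBall x R ⊆ Ω)
    (hχ : ContDiff ℝ ∞ χ) (hχx : χ =ᶠ[𝓝 x] fun _ => 1)
    (hχr : tsupport χ ⊆ Metric.closedBall x r)
    (huc : ContinuousOn u (Metric.closedBall x R))
    (huw : ∀ φ : E d → ℝ, ContDiff ℝ 1 φ → tsupport φ ⊆ Metric.closedBall x R →
      ∫ y in Ω, gradDot (G y) (fderiv ℝ φ y) = 0)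
    (hu0 : ∫ y, u y ∂(surfaceMeasure Ω) = 0) :
    ∫ y in Ω, gradDot (G y) (fderiv ℝ (fun z => (1 - χ z) * f z) y) = u x := by
  have hχΩ : tsupport χ ⊆ Ω :=
    (hχr.trans (Metric.closedBall_subset_closedBall hrR.le)).trans hRΩ
  have hχc : HasCompactSupport χ :=
    (isCompact_closedBall x r).of_isClosed_subset (isClosed_tsupport χ) hχr
  have hb := continuous_reprKernel hΩ hf hχ hχx hχΩ
  have hbs := tsupport_reprKernel_subset f χ
  have hbc : HasCompactSupport (reprKernel f χ) :=
    hχc.of_isClosed_subset (isClosed_tsupport _) hbs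
  have hrep : u x = ∫ y in Ω, u y * reprKernel f χ y := by
    refine eq_integral_mul_of_weakly_harmonic hr hrR hΩ hRΩ hu.integrable huc ?_ hb
      (hbs.trans hχr) ?_
    · intro ψ hψ hψR
      exact hu.integral_mul_lap_eq_zero hΩ (by exact_mod_cast contDiff_infty.1 hψ 2)
        ((isCompact_closedBall x R).of_isClosed_subset (isClosed_tsupport ψ) hψR)
        (hψR.trans hRΩ) (huw ψ (hψ.of_le (by simp)) hψR)
    · intro v hv hvl
      exact eq_integral_mul_reprKernel hΩ hfW hfw hχ hχx.eq_of_nhds hχc hχΩ hv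
        (fun y hy => hvl y (hχr hy)) hb
  have hζ : ContDiff ℝ 1 fun z => 1 - χ z := (contDiff_const.sub hχ).of_le (by simp)
  have hζx : (fun z => 1 - χ z) =ᶠ[𝓝 x] fun _ => 0 := by
    filter_upwards [hχx] with y hy
    simp [hy]
  obtain ⟨hiB, hB⟩ := hu.integral_cutoff hΩ hΩb hf hfw hζ hζx (fun y hy => by
    rw [hΩ.frontier_eq] at hy
    simp [image_eq_zero_of_notMem_tsupport fun h => hy.2 (hχΩ h)])
  rw [hu0, mul_zero, neg_zero] at hB
  have hpχ : ∀ i, ContDiff ℝ ∞ (pd i χ) := fun i => contDiff_pd hχ le_rfl i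
  have hpx : ∀ i, pd i χ =ᶠ[𝓝 x] fun _ => 0 := fun i => pd_eventuallyEq_zero hχx i
  have hps : ∀ i, tsupport (pd i χ) ⊆ tsupport χ := fun i => tsupport_pd_subset χ i
  have hψs : ∀ i, tsupport (fun y => f y * pd i χ y) ⊆ tsupport χ := fun i =>
    (tsupport_mul_subset_right (f := f)).trans (hps i)
  -- Divergence theorem for `u` with the field `f ∇χ`, which is `C¹` because `∇χ` vanishes near the
  -- pole.
  obtain ⟨hiW, hW⟩ := hu.integral_div hΩ
    (fun i => hf.contDiff_mul hΩ isClosed_singleton ((hpχ i).of_le (by simp))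
      ((hps i).trans hχΩ) (by rintro z rfl; exact hpx i))
    (fun i => hχc.of_isClosed_subset (isClosed_tsupport _) (hψs i)) (fun i => (hψs i).trans hχΩ)
  obtain ⟨C, hC⟩ := hb.bounded_above_of_compact_support hbc
  have hib : Integrable (fun y => u y * reprKernel f χ y) (volume.restrict Ω) :=
    hu.integrable.mul_bdd hb.aestronglyMeasurable (Eventually.of_forall hC)
  -- Pointwise, the integrand of the goal is the kernel term plus the cutoff identity minus the
  -- divergence identity; the last two integrate to `0`.
  have hsub := integral_sub (hib.add hiB) hiW
  simp only [Pi.add_apply] at hsub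
  rw [integral_add hib hiB, hB, hW, add_zero, sub_zero] at hsub
  rw [hrep, ← hsub]
  refine setIntegral_congr_fun hΩ.measurableSet fun y hy => ?_
  have hDζ : fderiv ℝ (fun z => 1 - χ z) y = - fderiv ℝ χ y := by
    simp [fderiv_const_sub]
  -- No product rule for `f` is available at the pole, but there both sides vanish because `χ` is
  -- locally constant.
  by_cases hyx : y = x
  · subst hyx
    have h1 : (fun z => (1 - χ z) * f z) =ᶠ[𝓝 y] fun _ => 0 := by
      filter_upwards [hχx] with z hz
      simp [hz]
    have h2 := (fderiv_eventuallyEq_zero hχx).eq_of_nhds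
    have h3 := fun i => (hpx i).eq_of_nhds
    have h5 : ∀ i, pd i (fun z => f z * pd i χ z) y = 0 := fun i => by
      have : (fun z => f z * pd i χ z) =ᶠ[𝓝 y] fun _ => 0 := by
        filter_upwards [hpx i] with z hz
        simp [hz]
      exact (pd_eventuallyEq_zero this i).eq_of_nhds
    have h6 : lap χ y = 0 :=
      Finset.sum_eq_zero fun i _ => (pd_eventuallyEq_zero (hpx i) i).eq_of_nhds
    have h7 := (fderiv_eventuallyEq_zero h1).eq_of_nhds
    simp [h7, h2, h3, h5, h6, hDζ, hχx.eq_of_nhds, gradDot, reprKernel]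
  · have hfy := hf.differentiableAt ⟨hy, hyx⟩
    have h1 := gradDot_fderiv_mul (A := G y) (hζ.differentiable one_ne_zero y) hfy
    have h2 : ∀ i, pd i (fun z => f z * pd i χ z) y = f y * pd i (pd i χ) y + pd i χ y * pd i f y :=
      fun i => pd_mul hfy ((hpχ i).differentiable (by simp) y) i
    have h3 : gradDot (fderiv ℝ f y) (fderiv ℝ χ y) = ∑ i, pd i χ y * pd i f y := rfl
    have h4 : gradDot (G y) (fderiv ℝ χ y) =
      ∑ i, pd i χ y * G y (EuclideanSpace.single i 1) := rfl
    have hneg : ∀ A : E d →L[ℝ] ℝ, gradDot A (-fderiv ℝ χ y) = - gradDot A (fderiv ℝ χ y) := by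
      intro A; simp [gradDot]
    have h5 : ∑ i, (u y * pd i (fun z => f z * pd i χ z) y +
        f y * pd i χ y * G y (EuclideanSpace.single i 1)) =
        u y * f y * lap χ y + u y * gradDot (fderiv ℝ f y) (fderiv ℝ χ y) +
          f y * gradDot (G y) (fderiv ℝ χ y) := by
      simp only [h2, h3, h4, lap, Finset.mul_sum, ← Finset.sum_add_distrib]
      exact Finset.sum_congr rfl fun i _ => by ring
    simp only [h1, h5, hDζ, hneg, reprKernel, gradDot_comm (fderiv ℝ f y) (G y)]
    ring

/-! ### The Neumann function: test functions and symmetry. -/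

theorem notMem_of_mem_frontier (hΩ : IsOpen Ω) {p : E d} (hp : p ∈ frontier Ω) : p ∉ Ω := by
  rw [hΩ.frontier_eq] at hp
  exact hp.2

/-- The witness `(1 - χ) * N x` depends only on `x` and `R`, so one test function serves both for `N
z` and for the real and imaginary parts of the potential. -/
theorem IsNeumannFunction.exists_test {N : E d → E d → ℝ} (hN : IsNeumannFunction Ω N)
    (hΩ : IsC1Domain Ω) {x : E d} (hx : x ∈ Ω) {R : ℝ} (hR : 0 < R)
    (hRΩ : Metric.closedBall x R ⊆ Ω) :
    ∃ φ : E d → ℝ, IsC1UpToBoundary Ω ∅ φ ∧ (∀ y ∉ Metric.closedBall x R, φ y = N x y) ∧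
      ∀ (u : E d → ℝ) (G : E d → E d →L[ℝ] ℝ), HasW11Grad Ω u G →
        ContinuousOn u (Metric.closedBall x R) →
        (∀ ψ : E d → ℝ, ContDiff ℝ 1 ψ → tsupport ψ ⊆ Metric.closedBall x R →
          ∫ y in Ω, gradDot (G y) (fderiv ℝ ψ y) = 0) →
        ∫ y, u y ∂(surfaceMeasure Ω) = 0 →
        ∫ y in Ω, gradDot (G y) (fderiv ℝ φ y) = u x := by
  -- The support has radius `R / 2`, strictly less than `R`, which leaves room for the
  -- mollification.
  let χ : ContDiffBump x := ⟨R / 4, R / 2, by positivity, by linarith⟩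
  have hχ1 : (χ : E d → ℝ) =ᶠ[𝓝 x] fun _ => 1 := χ.eventuallyEq_one
  refine ⟨fun z => (1 - χ z) * N x z, (hN.isC1 x hx).mul_left isClosed_singleton
    (contDiff_const.sub χ.contDiff) ?_, fun y hy => ?_, fun u G hu huc huw hu0 => ?_⟩
  · rintro z rfl
    filter_upwards [hχ1] with y hy
    simp [hy]
  · have : χ y = 0 := χ.zero_of_le_dist (by
      rw [Metric.mem_closedBall, not_le] at hy
      change R / 2 ≤ _
      linarith)
    simp [this]
  · exact hu.eq_integral_gradDot hΩ.isOpen hΩ.isBounded (hN.isC1 x hx) (hN.hasW11Grad x hx)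
      (hN.weak_form x hx) (by positivity : 0 ≤ R / 2) (by linarith) hRΩ χ.contDiff hχ1
      χ.tsupport_eq.subset huc huw hu0

/-- The Neumann function is symmetric. -/
theorem IsNeumannFunction.symm_of_mem {N : E d → E d → ℝ} (hN : IsNeumannFunction Ω N)
    (hΩ : IsC1Domain Ω) {x z : E d} (hx : x ∈ Ω) (hz : z ∈ Ω) (hxz : x ≠ z) : N z x = N x z := by
  -- The ball avoids `z`, so `N z` is continuous and weakly harmonic on it; moreover the test
  -- function still equals `N x` at `z`.
  obtain ⟨R, hR, hRΩ⟩ := Metric.nhds_basis_closedBall.mem_iff.1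
    ((hΩ.isOpen.sdiff isClosed_singleton).mem_nhds (show x ∈ Ω \ {z} from ⟨hx, hxz⟩))
  have hRΩ' : Metric.closedBall x R ⊆ Ω := hRΩ.trans sdiff_subset
  have hzR : z ∉ Metric.closedBall x R := fun h => (hRΩ h).2 rfl
  have hfr : ∀ y ∈ frontier Ω, y ∉ Metric.closedBall x R := fun y hy h =>
    notMem_of_mem_frontier hΩ.isOpen hy (hRΩ' h)
  obtain ⟨φ, hφ, hφN, h⟩ := hN.exists_test hΩ hx hR hRΩ'
  rw [← h (N z) _ (hN.hasW11Grad z hz)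
    ((hN.isC1 z hz).1.mono (hRΩ.trans (sdiff_subset_sdiff_left subset_closure))) ?_
    (hN.integral_boundary z hz), hN.weak_form z hz φ hφ, hφN z hzR]
  · have : ∫ y, φ y ∂(surfaceMeasure Ω) = 0 := by
      rw [← hN.integral_boundary x hx]
      exact setIntegral_congr_fun isClosed_frontier.measurableSet fun y hy => hφN y (hfr y hy)
    rw [this, mul_zero, sub_zero]
  · intro ψ hψ hψR
    have h0 : ∀ y ∉ Metric.closedBall x R, ψ y = 0 := fun y hy =>
      image_eq_zero_of_notMem_tsupport fun h => hy (hψR h)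
    have : ∫ y, ψ y ∂(surfaceMeasure Ω) = 0 :=
      setIntegral_eq_zero_of_forall_eq_zero fun y hy => h0 y (hfr y hy)
    rw [hN.weak_form z hz ψ hψ.isC1UpToBoundary, h0 z hzR, this, mul_zero, sub_zero]

/-- The equations hold only for interior poles, so both arguments approach their limits from inside
`Ω`, and the values are recovered from joint continuity off the diagonal. -/
theorem IsNeumannFunction.symm {N : E d → E d → ℝ} (hN : IsNeumannFunction Ω N)
    (hΩ : IsC1Domain Ω) {p q : E d} (hp : p ∈ closure Ω) (hq : q ∈ closure Ω) (hpq : p ≠ q) :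
    N p q = N q p := by
  have := mem_closure_iff_nhdsWithin_neBot.1 hp
  have := mem_closure_iff_nhdsWithin_neBot.1 hq
  have hev : ∀ {p q : E d}, p ≠ q →
      ∀ᶠ a : E d × E d in 𝓝[Ω] p ×ˢ 𝓝[Ω] q, a.1 ∈ Ω ∧ a.2 ∈ Ω ∧ a.1 ≠ a.2 := by
    intro p q hpq
    have h1 : ∀ᶠ a in 𝓝[Ω] p ×ˢ 𝓝[Ω] q, a.1 ∈ Ω ∧ a.2 ∈ Ω :=
      (eventually_mem_nhdsWithin (a := p)).prod_mk eventually_mem_nhdsWithin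
    have h2 : ∀ᶠ a : E d × E d in 𝓝[Ω] p ×ˢ 𝓝[Ω] q, a.1 ≠ a.2 :=
      (Filter.prod_mono nhdsWithin_le_nhds nhdsWithin_le_nhds).trans_eq nhds_prod_eq.symm
        ((isOpen_ne_fun continuous_fst continuous_snd).mem_nhds hpq)
    filter_upwards [h1, h2] with a h1 h2 using ⟨h1.1, h1.2, h2⟩
  have key : ∀ {p q : E d}, p ∈ closure Ω → q ∈ closure Ω → p ≠ q →
      Tendsto (fun a : E d × E d => N a.1 a.2) (𝓝[Ω] p ×ˢ 𝓝[Ω] q) (𝓝 (N p q)) := by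
    intro p q hp hq hpq
    refine (hN.continuousOn (p, q) ⟨hp, hq, hpq⟩).tendsto.comp (f := id)
      (tendsto_nhdsWithin_iff.2 ⟨?_, ?_⟩)
    · rw [nhds_prod_eq]
      exact Filter.prod_mono nhdsWithin_le_nhds nhdsWithin_le_nhds
    · filter_upwards [hev hpq] with a h
      exact ⟨subset_closure h.1, subset_closure h.2.1, h.2.2⟩
  refine tendsto_nhds_unique (key hp hq hpq)
    (((key hq hp hpq.symm).comp tendsto_prod_swap).congr' ?_)
  filter_upwards [hev hpq] with a h
  exact hN.symm_of_mem hΩ h.2.1 h.1 h.2.2.symm |>.symm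

/-! ### The point electrode model with constant admittivity. -/

theorem IsC1UpToBoundary.integrable_gradDot {G : E d → E d →L[ℝ] ℂ} {φ : E d → ℝ}
    (hφ : IsC1UpToBoundary Ω ∅ φ) (hΩ : IsOpen Ω) (hΩb : Bornology.IsBounded Ω)
    (hG : IntegrableOn G Ω) :
    Integrable (fun y => gradDot (G y) (fderiv ℝ φ y)) (volume.restrict Ω) := by
  obtain ⟨C, hC⟩ := hφ.exists_bound_fderiv_pairing hΩb isClosed_empty (ζ := fun _ => (1 : ℝ))
    continuous_const (fun x hx => absurd hx (notMem_empty x)) (B := fun A s => s • A)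
    (continuous_snd.smul continuous_fst) (by simp)
  refine integrable_finsetSum _ fun i _ => ?_
  refine Integrable.bdd_smul (φ := fun y => fderiv ℝ φ y (EuclideanSpace.single i 1))
    (C := C * ‖(EuclideanSpace.single i 1 : E d)‖) ?_ ?_ ?_
  · exact hG.apply_continuousLinearMap _
  · exact (measurable_fderiv_apply_const ℝ φ _).aestronglyMeasurable
  · filter_upwards [ae_restrict_mem hΩ.measurableSet] with y hy
    exact (fderiv ℝ φ y).le_of_opNorm_le (by simpa using hC y hy) _

/-- Representation of the solution of the point electrode model with constant admittivity by the
Neumann function, in the interior. -/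
theorem IsPointElectrodeSolution.eq_of_mem {N : E d → E d → ℝ} (hN : IsNeumannFunction Ω N)
    (hΩ : IsC1Domain Ω) {γ : E d → ℂ} {γ₀ : ℂ} (hγ : ∀ x ∈ Ω, γ x = γ₀) (hγ₀ : γ₀ ≠ 0) {I : ℝ}
    {pp pm : E d} (hpp : pp ∈ frontier Ω) (hpm : pm ∈ frontier Ω) {u : E d → ℂ}
    (hu : IsPointElectrodeSolution Ω γ I pp pm u) {x : E d} (hx : x ∈ Ω) :
    u x = I / γ₀ * ((N x pp : ℂ) - (N x pm : ℂ)) := by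
  obtain ⟨hc, ⟨G, hG, -, hw⟩, hu0⟩ := hu
  have hpΩ : ∀ y ∈ Ω, y ∉ ({pp, pm} : Set (E d)) := by
    rintro y hy (rfl | rfl)
    exacts [notMem_of_mem_frontier hΩ.isOpen hpp hy, notMem_of_mem_frontier hΩ.isOpen hpm hy]
  obtain ⟨R, hR, hRΩ⟩ := Metric.nhds_basis_closedBall.mem_iff.1 (hΩ.isOpen.mem_nhds hx)
  obtain ⟨φ, hφ, hφN, h⟩ := hN.exists_test hΩ hx hR hRΩ
  have hfr : ∀ y ∈ frontier Ω, y ∉ Metric.closedBall x R := fun y hy h =>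
    notMem_of_mem_frontier hΩ.isOpen hy (hRΩ h)
  have hw' : ∀ ψ : E d → ℝ, IsC1UpToBoundary Ω ∅ ψ →
      ∫ y in Ω, gradDot (G y) (fderiv ℝ ψ y) = I / γ₀ * ((ψ pp : ℂ) - (ψ pm : ℂ)) := by
    intro ψ hψ
    have h1 := hw ψ hψ
    rw [setIntegral_congr_fun hΩ.isOpen.measurableSet
      (g := fun y => γ₀ * gradDot (G y) (fderiv ℝ ψ y)) fun y hy => by simp only [hγ y hy],
      integral_const_mul] at h1
    rw [div_mul_eq_mul_div, eq_div_iff hγ₀, mul_comm, h1]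
  -- The real theory applies to each real functional of `u`; the real and imaginary parts then
  -- determine the complex value.
  have hL : ∀ L : ℂ →L[ℝ] ℝ, L (u x) = L (I / γ₀ * ((N x pp : ℂ) - (N x pm : ℂ))) := by
    intro L
    have hLw : ∀ ψ : E d → ℝ, IsC1UpToBoundary Ω ∅ ψ →
        ∫ y in Ω, gradDot (L.comp (G y)) (fderiv ℝ ψ y) =
          L (I / γ₀ * ((ψ pp : ℂ) - (ψ pm : ℂ))) := by
      intro ψ hψ
      rw [← hw' ψ hψ, ← L.integral_comp_comm
        (hψ.integrable_gradDot hΩ.isOpen hΩ.isBounded hG.integrable_grad)]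
      simp [gradDot, -Complex.real_smul]
    rw [← h (fun y => L (u y)) _ (hG.clm_comp hΩ.isOpen L)
      (L.continuous.comp_continuousOn (hc.mono fun y hy =>
        ⟨subset_closure (hRΩ hy), hpΩ y (hRΩ hy)⟩)) ?_ ?_, hLw φ hφ, hφN pp (hfr pp hpp),
      hφN pm (hfr pm hpm)]
    · intro ψ hψ hψR
      have h0 : ∀ y ∉ Metric.closedBall x R, ψ y = 0 := fun y hy =>
        image_eq_zero_of_notMem_tsupport fun h => hy (hψR h)
      rw [hLw ψ hψ.isC1UpToBoundary, h0 pp (hfr pp hpp), h0 pm (hfr pm hpm)]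
      simp
    · rw [L.integral_comp_comm hG.integrable_trace, hu0, map_zero]
  exact Complex.ext (hL Complex.reCLM) (hL Complex.imCLM)

/-- Representation of the solution of the point electrode model with constant admittivity by the
Neumann function, on the boundary. -/
theorem IsPointElectrodeSolution.eq_of_mem_frontier {N : E d → E d → ℝ}
    (hN : IsNeumannFunction Ω N)
    (hΩ : IsC1Domain Ω) {γ : E d → ℂ} {γ₀ : ℂ} (hγ : ∀ x ∈ Ω, γ x = γ₀) (hγ₀ : γ₀ ≠ 0) {I : ℝ}
    {pp pm : E d} (hpp : pp ∈ frontier Ω) (hpm : pm ∈ frontier Ω) {u : E d → ℂ}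
    (hu : IsPointElectrodeSolution Ω γ I pp pm u) {q : E d} (hq : q ∈ frontier Ω)
    (hqp : q ≠ pp) (hqm : q ≠ pm) :
    u q = I / γ₀ * ((N pp q : ℂ) - (N pm q : ℂ)) := by
  have hcl := frontier_subset_closure (s := Ω)
  have := mem_closure_iff_nhdsWithin_neBot.1 (hcl hq)
  have hpΩ : ∀ {p}, p ∈ frontier Ω → ∀ y ∈ Ω, y ≠ p := by
    rintro p hp y hy rfl
    exact notMem_of_mem_frontier hΩ.isOpen hp hy
  have hut : Tendsto u (𝓝[Ω] q) (𝓝 (u q)) :=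
    (hu.continuousOn q ⟨hcl hq, by simp [hqp, hqm]⟩).mono fun y hy =>
      ⟨subset_closure hy, by simp [hpΩ hpp y hy, hpΩ hpm y hy]⟩
  have hNt : ∀ {p}, p ∈ frontier Ω → q ≠ p →
      Tendsto (fun y => (N y p : ℂ)) (𝓝[Ω] q) (𝓝 (N p q : ℂ)) := by
    intro p hp hqp
    -- As `y` tends to `q`, `N y p` tends to `N q p`; symmetry puts the injection point first.
    rw [hN.symm hΩ (hcl hp) (hcl hq) hqp.symm]
    refine (Complex.continuous_ofReal.tendsto _).comp ?_
    have h1 : ContinuousWithinAt (fun y : E d => (y, p)) Ω q := by fun_prop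
    exact ContinuousWithinAt.comp (f := fun y => (y, p)) (x := q)
      (hN.continuousOn (q, p) ⟨hcl hq, hcl hp, hqp⟩) h1 fun y hy =>
        ⟨subset_closure hy, hcl hp, hpΩ hp y hy⟩
  refine tendsto_nhds_unique (hut.congr' ?_) (((hNt hpp hqp).sub (hNt hpm hqm)).const_mul _)
  filter_upwards [self_mem_nhdsWithin] with y hy
  exact hu.eq_of_mem hN hΩ hγ hγ₀ hpp hpm hy

/-- A vanishing admittivity admits no net current. -/
theorem IsPointElectrodeSolution.eq_of_admittivity_eq_zero (hΩ : IsOpen Ω) {γ : E d → ℂ}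
    (hγ : ∀ x ∈ Ω, γ x = 0) {I : ℝ} {pp pm : E d} {u : E d → ℂ}
    (hu : IsPointElectrodeSolution Ω γ I pp pm u) : I = 0 ∨ pp = pm := by
  obtain ⟨-, ⟨G, -, -, hw⟩, -⟩ := hu
  rw [or_iff_not_imp_left]
  intro hI
  ext i
  -- Coordinate functions as test functions separate the two injection points.
  have h1 := hw (EuclideanSpace.proj i : E d →L[ℝ] ℝ)
    (EuclideanSpace.proj i : E d →L[ℝ] ℝ).contDiff.isC1UpToBoundary
  rw [setIntegral_congr_fun hΩ.measurableSet (g := fun _ => (0 : ℂ)) fun y hy => by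
    simp [hγ y hy], integral_zero, eq_comm, mul_eq_zero, or_iff_right (by exact_mod_cast hI),
    sub_eq_zero] at h1
  exact_mod_cast h1

end EIT

theorem lemma2p1 {d : ℕ} (hd : d = 2 ∨ d = 3) (Ω : Set (EIT.E d)) (hΩ : EIT.IsC1Domain Ω)
    (N₁ : EIT.E d → EIT.E d → ℝ) (hN : EIT.IsNeumannFunction Ω N₁)
    (γ : EIT.E d → ℂ) (γ₀ : ℂ) (hγ : ∀ x ∈ Ω, γ x = γ₀) (I : ℝ)
    (pkp pkm plp plm : EIT.E d)
    (hkp : pkp ∈ frontier Ω) (hkm : pkm ∈ frontier Ω)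
    (hlp : plp ∈ frontier Ω) (hlm : plm ∈ frontier Ω)
    (hlpkp : plp ≠ pkp) (hlpkm : plp ≠ pkm) (hlmkp : plm ≠ pkp) (hlmkm : plm ≠ pkm)
    (u : EIT.E d → ℂ) (hu : EIT.IsPointElectrodeSolution Ω γ I pkp pkm u)
    (hU : EIT.voltage u plp plm ≠ 0) :
    γ₀ = (I : ℂ) / EIT.voltage u plp plm *
      ((N₁ pkp plp : ℂ) - (N₁ pkp plm : ℂ) - (N₁ pkm plp : ℂ) + (N₁ pkm plm : ℂ)) := by
  -- For zero admittivity the right-hand side vanishes as well: either `I = 0`, or the injection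
  -- points coincide and the four terms cancel.
  by_cases hγ₀ : γ₀ = 0
  · subst hγ₀
    rcases hu.eq_of_admittivity_eq_zero hΩ.isOpen hγ with rfl | rfl
    · simp
    · ring
  · have h1 := hu.eq_of_mem_frontier hN hΩ hγ hγ₀ hkp hkm hlp hlpkp hlpkm
    have h2 := hu.eq_of_mem_frontier hN hΩ hγ hγ₀ hkp hkm hlm hlmkp hlmkm
    rw [div_mul_eq_mul_div, eq_div_iff hU, EIT.voltage, h1, h2]
    field_simp
    ring
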